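/- Let $(\mathscr{C},\mathbb{E},\mathfrak{s})$ be an extriangulated category (in the sense of Nakaoka--Palu). A sequence $A\to B\to C$ realizing some $\delta\in\mathbb{E}(C,A)$ is called a conflation; its first morphism is an inflation with cone $C$, and its second morphism is a deflation. All subcategories are full and closed under isomorphisms. For a subcategory $\mathcal{D}$, a conflation in $\mathcal{D}$ is a conflation of $\mathscr{C}$ whose three terms lie in $\mathcal{D}$; inflations and deflations in $\mathcal{D}$ are the first and second morphisms of such conflations. A subcategory $\mathcal{D}$ containing $0$ is called wide if (a) $\mathcal{D}$ is extension-closed, that is, $\mathcal{D}=\mathcal{D}*\mathcal{D}$, where $\mathcal{D}*\mathcal{D}$ consists of all objects $M$ admitting a conflation $A\to M\to B$ with $A,B\in\mathcal{D}$; and (b) every morphism $f$ in $\mathcal{D}$ is admissible, that is, $f=ip$ with $p$ a deflation in $\mathcal{D}$ and $i$ an inflation in $\mathcal{D}$. Let $\mathrm{sim}(\mathcal{D})$ be the collection of (isomorphism classes of) nonzero objects $M\in\mathcal{D}$ for which there is no conflation $A\to M\to B$ in $\mathcal{D}$ with $A\neq 0$ and $B\neq 0$. For a collection $\mathcal{X}$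 of (isomorphism classes of) objects, let $\mathbf{Filt}_{\mathcal{D}}(\mathcal{X})$ be the subcategory of all objects $M$ admitting a finite filtration $0=X_0\to X_1\to\cdots\to X_n=M$ ($n\ge 0$) in $\mathcal{D}$ in which each $X_i\to X_{i+1}$ is an inflation in $\mathcal{D}$ with cone in $\mathcal{X}$. The subcategory $\mathcal{D}$ is called length if $\mathcal{D}=\mathbf{Filt}_{\mathcal{D}}(\mathrm{sim}(\mathcal{D}))$. A semibrick is a collection $\mathcal{X}$ of isomorphism classes of objects of $\mathscr{C}$ such that $\mathrm{End}(X)$ is a division ring for every $X\in\mathcal{X}$ and $\mathrm{Hom}(X_1,X_2)=0$ for any two non-isomorphic $X_1,X_2\in\mathcal{X}$. The collection $\mathcal{X}$ is called simple if $\mathcal{X}\subseteq\mathrm{sim}(\mathbf{Filt}_{\mathscr{C}}(\mathcal{X}))$. Proposition. Let $\mathcal{X}$ be a semibrick in $\mathscr{C}$. Then $\mathbf{Filt}_{\mathscr{C}}(\mathcal{X})$ is a wide subcategory of $\mathscr{C}$. If moreover $\mathcal{X}$ is simple, then $\mathbf{Filt}_{\mathscr{C}}(\mathcal{X})$ is a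 length wide subcategory and $\mathrm{sim}(\mathbf{Filt}_{\mathscr{C}}(\mathcal{X}))=\mathcal{X}$. -/

import Mathlib

open CategoryTheory CategoryTheory.Limits

universe w v u

namespace Extriangulated

/-! ### Sequences `A ⟶ B ⟶ C` with fixed ends, up to equivalence -/

/-- A sequence of morphisms `A ⟶ mid ⟶ C` with fixed ends `A` and `C`. -/
structure ShortSeq {𝒞 : Type u} [Category.{v} 𝒞] (A C : 𝒞) where
  /-- the middle term -/
  mid : 𝒞
  /-- the first morphism -/
  inc : A ⟶ mid
  /-- the second morphism -/
  proj : mid ⟶ C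

/-- Two sequences with the same ends are equivalent if there is an isomorphism between their
middle terms which is compatible with the identities of the ends. -/
def ShortSeq.Equivalent {𝒞 : Type u} [Category.{v} 𝒞] {A C : 𝒞} (S T : ShortSeq A C) : Prop :=
  ∃ b : S.mid ≅ T.mid, S.inc ≫ b.hom = T.inc ∧ b.hom ≫ T.proj = S.proj

theorem ShortSeq.equivalent_equivalence {𝒞 : Type u} [Category.{v} 𝒞] (A C : 𝒞) :
    Equivalence (ShortSeq.Equivalent (A := A) (C := C)) where
  refl S := ⟨Iso.refl _, by simp, by simp⟩
  symm := by
    rintro S T ⟨b, h₁, h₂⟩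
    exact ⟨b.symm, by simp [← h₁], by simp [← h₂]⟩
  trans := by
    rintro S T U ⟨b, h₁, h₂⟩ ⟨c, k₁, k₂⟩
    exact ⟨b ≪≫ c, by simp [reassoc_of% h₁, k₁], by simp [k₂, h₂]⟩

/-- The setoid of sequences with fixed ends. -/
def ShortSeq.setoid {𝒞 : Type u} [Category.{v} 𝒞] (A C : 𝒞) : Setoid (ShortSeq A C) :=
  ⟨ShortSeq.Equivalent, ShortSeq.equivalent_equivalence A C⟩

/-- Equivalence classes of sequences `A ⟶ B ⟶ C` with fixed ends `A` and `C`. -/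
def SeqClass {𝒞 : Type u} [Category.{v} 𝒞] (A C : 𝒞) : Type (max u v) :=
  Quotient (ShortSeq.setoid A C)

/-- The equivalence class `[A ⟶ B ⟶ C]`. -/
def SeqClass.mk {𝒞 : Type u} [Category.{v} 𝒞] {A B C : 𝒞} (x : A ⟶ B) (y : B ⟶ C) :
    SeqClass A C :=
  Quotient.mk (ShortSeq.setoid A C) ⟨B, x, y⟩

/-! ### `𝔼`-extensions for a bifunctor `𝔼 : 𝒞ᵒᵖ × 𝒞 ⥤ Ab` -/

/-- The group `𝔼(C, A)` of `𝔼`-extensions. -/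
abbrev Ext {𝒞 : Type u} [Category.{v} 𝒞] (𝔼 : 𝒞ᵒᵖ ⥤ 𝒞 ⥤ AddCommGrpCat.{w}) (C A : 𝒞) : Type w :=
  (𝔼.obj (Opposite.op C)).obj A

/-- `a_* δ = 𝔼(C, a)(δ)`. -/
def push {𝒞 : Type u} [Category.{v} 𝒞] (𝔼 : 𝒞ᵒᵖ ⥤ 𝒞 ⥤ AddCommGrpCat.{w}) {C A A' : 𝒞}
    (a : A ⟶ A') (δ : Ext 𝔼 C A) : Ext 𝔼 C A' :=
  ((𝔼.obj (Opposite.op C)).map a).hom δ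

/-- `c^* δ = 𝔼(c, A)(δ)`. -/
def pull {𝒞 : Type u} [Category.{v} 𝒞] (𝔼 : 𝒞ᵒᵖ ⥤ 𝒞 ⥤ AddCommGrpCat.{w}) {C C' A : 𝒞}
    (c : C' ⟶ C) (δ : Ext 𝔼 C A) : Ext 𝔼 C' A :=
  ((𝔼.map c.op).app A).hom δ

/-- The direct sum `δ ⊕ δ' ∈ 𝔼(C ⊞ C', A ⊞ A')`: the extension whose components in
`𝔼(C, A)`, `𝔼(C, A')`, `𝔼(C', A)`, `𝔼(C', A')` are `δ`, `0`, `0`, `δ'`. -/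
noncomputable def extSum {𝒞 : Type u} [Category.{v} 𝒞] [Preadditive 𝒞] [HasBinaryBiproducts 𝒞]
    (𝔼 : 𝒞ᵒᵖ ⥤ 𝒞 ⥤ AddCommGrpCat.{w}) {C C' A A' : 𝒞} (δ : Ext 𝔼 C A) (δ' : Ext 𝔼 C' A') :
    Ext 𝔼 (C ⊞ C') (A ⊞ A') :=
  push 𝔼 biprod.inl (pull 𝔼 biprod.fst δ) + push 𝔼 biprod.inr (pull 𝔼 biprod.snd δ')

/-! ### Extriangulated categories -/

/-- The structure `(𝔼, 𝔰)` of an extriangulated category on an additive category `𝒞`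
(in the sense of Nakaoka and Palu). -/
structure ExtriangulatedStructure (𝒞 : Type u) [Category.{v} 𝒞] [Preadditive 𝒞]
    [HasZeroObject 𝒞] [HasBinaryBiproducts 𝒞] where
  /-- the bifunctor `𝔼 : 𝒞ᵒᵖ × 𝒞 ⥤ Ab` -/
  𝔼 : 𝒞ᵒᵖ ⥤ 𝒞 ⥤ AddCommGrpCat.{w}
  /-- (ET1) `𝔼` is additive in the first variable. -/
  additive_left : 𝔼.Additive
  /-- (ET1) `𝔼` is additive in the second variable. -/
  additive_right : ∀ C : 𝒞ᵒᵖ, (𝔼.obj C).Additive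
  /-- the correspondence `𝔰`, which sends an extension to an equivalence class of sequences -/
  𝔰 : ∀ {A C : 𝒞}, Ext 𝔼 C A → SeqClass A C
  /-- (ET2) `𝔰` is a realization: every morphism of extensions is realized by a morphism of
  sequences. -/
  realization : ∀ {A B C A' B' C' : 𝒞} (δ : Ext 𝔼 C A) (δ' : Ext 𝔼 C' A')
    (x : A ⟶ B) (y : B ⟶ C) (x' : A' ⟶ B') (y' : B' ⟶ C'),
    𝔰 δ = SeqClass.mk x y → 𝔰 δ' = SeqClass.mk x' y' →
    ∀ (a : A ⟶ A') (c : C ⟶ C'), push 𝔼 a δ = pull 𝔼 c δ' →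
      ∃ b : B ⟶ B', x ≫ b = a ≫ x' ∧ y ≫ c = b ≫ y'
  /-- (ET2) split extensions are realized by split sequences. -/
  realize_zero : ∀ A C : 𝒞,
    𝔰 (0 : Ext 𝔼 C A) = SeqClass.mk (biprod.inl : A ⟶ A ⊞ C) (biprod.snd : A ⊞ C ⟶ C)
  /-- (ET2) `𝔰 (δ ⊕ δ') = 𝔰 δ ⊕ 𝔰 δ'`. -/
  realize_sum : ∀ {A B C A' B' C' : 𝒞} (δ : Ext 𝔼 C A) (δ' : Ext 𝔼 C' A')
    (x : A ⟶ B) (y : B ⟶ C) (x' : A' ⟶ B') (y' : B' ⟶ C'),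
    𝔰 δ = SeqClass.mk x y → 𝔰 δ' = SeqClass.mk x' y' →
    𝔰 (extSum 𝔼 δ δ') = SeqClass.mk (biprod.map x x') (biprod.map y y')
  /-- (ET3) -/
  et3 : ∀ {A B C A' B' C' : 𝒞} (δ : Ext 𝔼 C A) (δ' : Ext 𝔼 C' A')
    (x : A ⟶ B) (y : B ⟶ C) (x' : A' ⟶ B') (y' : B' ⟶ C'),
    𝔰 δ = SeqClass.mk x y → 𝔰 δ' = SeqClass.mk x' y' →
    ∀ (a : A ⟶ A') (b : B ⟶ B'), x ≫ b = a ≫ x' →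
      ∃ c : C ⟶ C', push 𝔼 a δ = pull 𝔼 c δ' ∧ y ≫ c = b ≫ y'
  /-- (ET3)ᵒᵖ -/
  et3_op : ∀ {A B C A' B' C' : 𝒞} (δ : Ext 𝔼 C A) (δ' : Ext 𝔼 C' A')
    (x : A ⟶ B) (y : B ⟶ C) (x' : A' ⟶ B') (y' : B' ⟶ C'),
    𝔰 δ = SeqClass.mk x y → 𝔰 δ' = SeqClass.mk x' y' →
    ∀ (b : B ⟶ B') (c : C ⟶ C'), y ≫ c = b ≫ y' →
      ∃ a : A ⟶ A', push 𝔼 a δ = pull 𝔼 c δ' ∧ x ≫ b = a ≫ x'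
  /-- (ET4) -/
  et4 : ∀ {A B C D F : 𝒞} (δ : Ext 𝔼 D A) (δ' : Ext 𝔼 F B)
    (f : A ⟶ B) (f' : B ⟶ D) (g : B ⟶ C) (g' : C ⟶ F),
    𝔰 δ = SeqClass.mk f f' → 𝔰 δ' = SeqClass.mk g g' →
      ∃ (E : 𝒞) (h : A ⟶ C) (h' : C ⟶ E) (d : D ⟶ E) (e : E ⟶ F) (δ'' : Ext 𝔼 E A),
        h = f ≫ g ∧ f' ≫ d = g ≫ h' ∧ h' ≫ e = g' ∧
        𝔰 δ'' = SeqClass.mk h h' ∧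
        𝔰 (push 𝔼 f' δ') = SeqClass.mk d e ∧
        pull 𝔼 d δ'' = δ ∧
        push 𝔼 f δ'' = pull 𝔼 e δ'
  /-- (ET4)ᵒᵖ -/
  et4_op : ∀ {A B C D F : 𝒞} (δ : Ext 𝔼 B D) (δ' : Ext 𝔼 C F)
    (f' : D ⟶ A) (f : A ⟶ B) (g' : F ⟶ B) (g : B ⟶ C),
    𝔰 δ = SeqClass.mk f' f → 𝔰 δ' = SeqClass.mk g' g →
      ∃ (E : 𝒞) (h' : E ⟶ A) (h : A ⟶ C) (d : D ⟶ E) (e : E ⟶ F) (δ'' : Ext 𝔼 C E),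
        h = f ≫ g ∧ d ≫ h' = f' ∧ h' ≫ f = e ≫ g' ∧
        𝔰 δ'' = SeqClass.mk h' h ∧
        𝔰 (pull 𝔼 g' δ) = SeqClass.mk d e ∧
        push 𝔼 e δ'' = δ' ∧
        push 𝔼 d δ = pull 𝔼 g δ''

namespace ExtriangulatedStructure

section

variable {𝒞 : Type u} [Category.{v} 𝒞] [Preadditive 𝒞] [HasZeroObject 𝒞] [HasBinaryBiproducts 𝒞]

/-- `A ⟶ B ⟶ C` is a conflation, i.e. it realizes some `𝔼`-extension and so is part of an
`𝔼`-triangle `A ⟶ B ⟶ C ⇢`. -/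
def IsConflation (S : ExtriangulatedStructure.{w} 𝒞) {A B C : 𝒞} (x : A ⟶ B) (y : B ⟶ C) : Prop :=
  ∃ δ : Ext S.𝔼 C A, S.𝔰 δ = SeqClass.mk x y

/-! A full subcategory is given by a property `𝒟` of objects. An extension-closed `𝒟` is an
extriangulated category itself, with the restrictions of `𝔼` and `𝔰`: its conflations are the
conflations of `𝒞` whose three terms lie in `𝒟`. The notions below are taken in `𝒟` in this
sense; for `𝒟 = ⊤` they are the notions in `𝒞`. -/

/-- Conflations in `𝒟`. -/
def IsConflationIn (S : ExtriangulatedStructure.{w} 𝒞) (𝒟 : ObjectProperty 𝒞) {A B C : 𝒞}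
    (x : A ⟶ B) (y : B ⟶ C) : Prop :=
  𝒟 A ∧ 𝒟 B ∧ 𝒟 C ∧ S.IsConflation x y

/-- Inflations in `𝒟`. -/
def IsInflationIn (S : ExtriangulatedStructure.{w} 𝒞) (𝒟 : ObjectProperty 𝒞) {A B : 𝒞}
    (x : A ⟶ B) : Prop :=
  ∃ (C : 𝒞) (y : B ⟶ C), S.IsConflationIn 𝒟 x y

/-- Deflations in `𝒟`. -/
def IsDeflationIn (S : ExtriangulatedStructure.{w} 𝒞) (𝒟 : ObjectProperty 𝒞) {B C : 𝒞}
    (y : B ⟶ C) : Prop :=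
  ∃ (A : 𝒞) (x : A ⟶ B), S.IsConflationIn 𝒟 x y

/-- `f` is admissible in `𝒟`: it is a deflation in `𝒟` followed by an inflation in `𝒟`. -/
def IsAdmissibleIn (S : ExtriangulatedStructure.{w} 𝒞) (𝒟 : ObjectProperty 𝒞) {A B : 𝒞}
    (f : A ⟶ B) : Prop :=
  ∃ (W : 𝒞) (p : A ⟶ W) (i : W ⟶ B),
    S.IsDeflationIn 𝒟 p ∧ S.IsInflationIn 𝒟 i ∧ f = p ≫ i

/-- `sim 𝒟`: the nonzero objects `M` of `𝒟` for which there is no conflation `A ⟶ M ⟶ B` in `𝒟`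
with `A` and `B` both nonzero. -/
def sim (S : ExtriangulatedStructure.{w} 𝒞) (𝒟 : ObjectProperty 𝒞) : ObjectProperty 𝒞 := fun M =>
  𝒟 M ∧ ¬ IsZero M ∧
    ¬ ∃ (A B : 𝒞) (x : A ⟶ M) (y : M ⟶ B), S.IsConflationIn 𝒟 x y ∧ ¬ IsZero A ∧ ¬ IsZero B

/-- `M` has an `𝒳`-filtration `0 = X₀ ⟶ X₁ ⟶ ⋯ ⟶ Xₙ = M` of length `n` in `𝒟`: each
`Xᵢ ⟶ Xᵢ₊₁` is an inflation in `𝒟` whose cone is in `𝒳`. -/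
def HasFiltration (S : ExtriangulatedStructure.{w} 𝒞) (𝒟 𝒳 : ObjectProperty 𝒞) :
    ℕ → ObjectProperty 𝒞
  | 0 => fun M => 𝒟 M ∧ IsZero M
  | n + 1 => fun M => ∃ (L N : 𝒞) (x : L ⟶ M) (y : M ⟶ N),
      S.HasFiltration 𝒟 𝒳 n L ∧ S.IsConflationIn 𝒟 x y ∧ 𝒳 N

/-- The filtration subcategory `Filt_𝒟(𝒳)` of `𝒟`. -/
def filtIn (S : ExtriangulatedStructure.{w} 𝒞) (𝒟 𝒳 : ObjectProperty 𝒞) : ObjectProperty 𝒞 :=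
  fun M => ∃ n : ℕ, S.HasFiltration 𝒟 𝒳 n M

/-- The filtration subcategory `Filt_𝒞(𝒳)` of the whole category. -/
def filt (S : ExtriangulatedStructure.{w} 𝒞) (𝒳 : ObjectProperty 𝒞) : ObjectProperty 𝒞 :=
  S.filtIn ⊤ 𝒳

/-- `𝒟 * 𝒟'`: the objects `M` with a conflation `A ⟶ M ⟶ B`, `A ∈ 𝒟`, `B ∈ 𝒟'`. -/
def star (S : ExtriangulatedStructure.{w} 𝒞) (𝒟 𝒟' : ObjectProperty 𝒞) : ObjectProperty 𝒞 :=
  fun M => ∃ (A B : 𝒞) (x : A ⟶ M) (y : M ⟶ B), 𝒟 A ∧ 𝒟' B ∧ S.IsConflation x y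

/-- `𝒟` is a wide subcategory: a full subcategory, closed under isomorphisms and containing the
zero objects, which is extension-closed and in which every morphism is admissible. -/
structure IsWide (S : ExtriangulatedStructure.{w} 𝒞) (𝒟 : ObjectProperty 𝒞) : Prop where
  closedUnderIso : 𝒟.IsClosedUnderIsomorphisms
  containsZero : ∀ Z : 𝒞, IsZero Z → 𝒟 Z
  extensionClosed : S.star 𝒟 𝒟 = 𝒟
  admissible : ∀ {M N : 𝒞} (f : M ⟶ N), 𝒟 M → 𝒟 N → S.IsAdmissibleIn 𝒟 f

/-- `𝒟` is length: `𝒟 = Filt_𝒟(sim 𝒟)`. -/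
def IsLength (S : ExtriangulatedStructure.{w} 𝒞) (𝒟 : ObjectProperty 𝒞) : Prop :=
  𝒟 = S.filtIn 𝒟 (S.sim 𝒟)

/-- A set `𝒳` of (isomorphism classes of) objects is simple if `𝒳 ⊆ sim (Filt_𝒞(𝒳))`. -/
def IsSimpleSet (S : ExtriangulatedStructure.{w} 𝒞) (𝒳 : ObjectProperty 𝒞) : Prop :=
  𝒳 ≤ S.sim (S.filt 𝒳)

end

end ExtriangulatedStructure

/-! ### Semibricks -/

/-- A brick: an object whose endomorphism ring is a division ring. -/
def IsBrick {𝒞 : Type u} [Category.{v} 𝒞] [Preadditive 𝒞] (M : 𝒞) : Prop :=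
  Nontrivial (End M) ∧ ∀ f : End M, f ≠ 0 → IsUnit f

/-- A semibrick: a set of isomorphism classes of objects, i.e. an isomorphism-closed property of
objects, consisting of bricks and without nonzero morphisms between nonisomorphic members. -/
structure IsSemibrick {𝒞 : Type u} [Category.{v} 𝒞] [Preadditive 𝒞] (𝒳 : ObjectProperty 𝒞) :
    Prop where
  closedUnderIso : 𝒳.IsClosedUnderIsomorphisms
  brick : ∀ M : 𝒞, 𝒳 M → IsBrick M
  hom_eq_zero : ∀ M N : 𝒞, 𝒳 M → 𝒳 N → ¬ Nonempty (M ≅ N) → ∀ f : M ⟶ N, f = 0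

end Extriangulated

/-!
Write `ℱ = Filt(𝒳)` for a semibrick `𝒳`. By (ET4) and its dual, `ℱ` is closed under extensions
(`filt_of_conflation`), and filtrations can be peeled off from the bottom as well as from the top
(`HasFiltration.exists_bottom`). The semibrick property enters through Schur's lemma: a nonzero
morphism between members of `𝒳` is an isomorphism. It gives that a nonzero morphism from `X ∈ 𝒳` to
an object of `ℱ` is an inflation with cone in `ℱ` (`exists_conflation_of_ne_zero`).

A morphism `f : M ⟶ N` in `ℱ` is shown to be admissible by induction on the length of a filtration
of `M`. Take a conflation `X ⟶ M ⟶ M'` with `X ∈ 𝒳` and `M'` of smaller length. If `X ⟶ M ⟶ N` is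
zero, then `f` factors through `M'`, and deflations compose. Otherwise `X ⟶ N` is an inflation and
`f` induces a morphism of conflations from `X ⟶ M ⟶ M'` to `X ⟶ N ⟶ N'`, whose last component
factors as a deflation `M' ⟶ W'` followed by an inflation `W' ⟶ N'`. The preimage `E` of `W'` in `N`
comes with an inflation `E ⟶ N` and, since `M` is the pullback of `E` and `M'` over `W'`
(`exists_pullback`), with a deflation `M ⟶ E`. Morphisms of conflations are not determined by their
ends, so `M ⟶ E ⟶ N` need not be `f`; but since `X` is a brick the two differ only by a unipotent
automorphism of `M`, which the deflation absorbs (`isAdmissibleIn_of_isAdmissibleIn_cone`).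

Finally, the top step `L ⟶ M ⟶ N` of a filtration of `M ∈ sim ℱ` is a conflation in `ℱ` with
`N ≠ 0`, so `L = 0` and `M ≅ N` is in `𝒳`. Hence `sim ℱ = 𝒳` when `𝒳` is simple, and `ℱ` is length
because every term of an `𝒳`-filtration lies in `ℱ`.
-/

namespace Extriangulated

/-! ### Functoriality of extensions -/

section Bifunctor

variable {𝒞 : Type u} [Category.{v} 𝒞] (𝔼 : 𝒞ᵒᵖ ⥤ 𝒞 ⥤ AddCommGrpCat.{w})

theorem push_id {C A : 𝒞} (δ : Ext 𝔼 C A) : push 𝔼 (𝟙 A) δ = δ := by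
  simp [push]

theorem push_comp {C A A' A'' : 𝒞} (a : A ⟶ A') (a' : A' ⟶ A'') (δ : Ext 𝔼 C A) :
    push 𝔼 (a ≫ a') δ = push 𝔼 a' (push 𝔼 a δ) := by
  simp [push]

theorem push_zero {C A A' : 𝒞} (a : A ⟶ A') : push 𝔼 a (0 : Ext 𝔼 C A) = 0 :=
  map_zero _

theorem push_add {C A A' : 𝒞} (a : A ⟶ A') (δ δ' : Ext 𝔼 C A) :
    push 𝔼 a (δ + δ') = push 𝔼 a δ + push 𝔼 a δ' :=
  map_add _ _ _

theorem pull_id {C A : 𝒞} (δ : Ext 𝔼 C A) : pull 𝔼 (𝟙 C) δ = δ := by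
  simp [pull]

theorem pull_comp {C C' C'' A : 𝒞} (c' : C'' ⟶ C') (c : C' ⟶ C) (δ : Ext 𝔼 C A) :
    pull 𝔼 (c' ≫ c) δ = pull 𝔼 c' (pull 𝔼 c δ) := by
  simp [pull]

theorem pull_zero {C C' A : 𝒞} (c : C' ⟶ C) : pull 𝔼 c (0 : Ext 𝔼 C A) = 0 :=
  map_zero _

theorem push_pull {C C' A A' : 𝒞} (a : A ⟶ A') (c : C' ⟶ C) (δ : Ext 𝔼 C A) :
    push 𝔼 a (pull 𝔼 c δ) = pull 𝔼 c (push 𝔼 a δ) := by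
  have h := (𝔼.map c.op).naturality a
  exact (congrArg (fun φ => φ.hom δ) h).symm

end Bifunctor

theorem SeqClass.mk_eq_iff {𝒞 : Type u} [Category.{v} 𝒞] {A B B' C : 𝒞} {x : A ⟶ B} {y : B ⟶ C}
    {x' : A ⟶ B'} {y' : B' ⟶ C} :
    SeqClass.mk x y = SeqClass.mk x' y' ↔ ∃ b : B ≅ B', x ≫ b.hom = x' ∧ b.hom ≫ y' = y :=
  ⟨fun h => Quotient.exact h, fun h => Quotient.sound h⟩

/-! ### Schur's lemma for semibricks -/

section Semibrick

variable {𝒞 : Type u} [Category.{v} 𝒞] [Preadditive 𝒞] {𝒳 : ObjectProperty 𝒞}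

theorem IsSemibrick.isIso_of_ne_zero (h𝒳 : IsSemibrick 𝒳) {X Y : 𝒞} (hX : 𝒳 X) (hY : 𝒳 Y)
    (f : X ⟶ Y) (hf : f ≠ 0) : IsIso f := by
  by_cases h : Nonempty (X ≅ Y)
  · obtain ⟨e⟩ := h
    have hu : IsUnit (show End X from f ≫ e.inv) := (h𝒳.brick X hX).2 _ fun h0 => hf <| by
      have h0' : f ≫ e.inv = 0 := h0
      rw [← cancel_mono e.inv, h0', zero_comp]
    have hi : IsIso (f ≫ e.inv) := (isUnit_iff_isIso _).1 hu
    exact IsIso.of_isIso_comp_right f e.inv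
  · exact absurd (h𝒳.hom_eq_zero X Y hX hY h f) hf

theorem IsSemibrick.not_isZero_of_mem (h𝒳 : IsSemibrick 𝒳) {X : 𝒞} (hX : 𝒳 X) :
    ¬ IsZero X := fun h =>
  have := (h𝒳.brick X hX).1
  one_ne_zero (α := End X) (h.eq_of_src _ _)

end Semibrick

namespace ExtriangulatedStructure

open scoped ZeroObject

variable {𝒞 : Type u} [Category.{v} 𝒞] [Preadditive 𝒞] [HasZeroObject 𝒞] [HasBinaryBiproducts 𝒞]
variable (S : ExtriangulatedStructure.{w} 𝒞)

/-! ### Split conflations -/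

theorem exists_realization {A C : 𝒞} (δ : Ext S.𝔼 C A) :
    ∃ (B : 𝒞) (x : A ⟶ B) (y : B ⟶ C), S.𝔰 δ = SeqClass.mk x y := by
  obtain ⟨⟨B, x, y⟩, h⟩ := Quotient.exists_rep (S.𝔰 δ)
  exact ⟨B, x, y, h.symm⟩

theorem push_zero_hom {C A A' : 𝒞} (δ : Ext S.𝔼 C A) : push S.𝔼 (0 : A ⟶ A') δ = 0 := by
  have := S.additive_right (Opposite.op C)
  simp [push]

theorem pull_zero_hom {C C' A : 𝒞} (δ : Ext S.𝔼 C A) : pull S.𝔼 (0 : C' ⟶ C) δ = 0 := by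
  have := S.additive_left
  simp [pull]

theorem eq_zero_of_isZero_left {C A : 𝒞} (hA : IsZero A) (δ : Ext S.𝔼 C A) : δ = 0 := by
  rw [← push_id S.𝔼 δ, hA.eq_of_src (𝟙 A) 0, push_zero_hom]

theorem eq_zero_of_isZero_right {C A : 𝒞} (hC : IsZero C) (δ : Ext S.𝔼 C A) : δ = 0 := by
  rw [← pull_id S.𝔼 δ, hC.eq_of_src (𝟙 C) 0, pull_zero_hom]

theorem realize_zero_of_iso {A B C : 𝒞} (e : A ⊞ C ≅ B) :
    S.𝔰 (0 : Ext S.𝔼 C A) = SeqClass.mk (biprod.inl ≫ e.hom) (e.inv ≫ biprod.snd) := by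
  rw [S.realize_zero, SeqClass.mk_eq_iff]
  exact ⟨e, rfl, by simp⟩

theorem realize_zero_swap (A C : 𝒞) :
    S.𝔰 (0 : Ext S.𝔼 A C) = SeqClass.mk (biprod.inr : C ⟶ A ⊞ C) biprod.fst := by
  rw [S.realize_zero, SeqClass.mk_eq_iff]
  exact ⟨biprod.braiding C A, by ext <;> simp, by ext <;> simp⟩

theorem realize_id_left (A : 𝒞) {Z : 𝒞} (hZ : IsZero Z) :
    S.𝔰 (0 : Ext S.𝔼 Z A) = SeqClass.mk (𝟙 A) (0 : A ⟶ Z) := by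
  rw [S.realize_zero, SeqClass.mk_eq_iff]
  refine ⟨⟨biprod.fst, biprod.inl, ?_, by simp⟩, by simp, hZ.eq_of_tgt _ _⟩
  ext <;> first | exact hZ.eq_of_src _ _ | simp

theorem realize_id_right (C : 𝒞) {Z : 𝒞} (hZ : IsZero Z) :
    S.𝔰 (0 : Ext S.𝔼 C Z) = SeqClass.mk (0 : Z ⟶ C) (𝟙 C) := by
  rw [S.realize_zero, SeqClass.mk_eq_iff]
  refine ⟨⟨biprod.snd, biprod.inr, ?_, by simp⟩, hZ.eq_of_src _ _, by simp⟩
  ext <;> first | exact hZ.eq_of_src _ _ | simp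

variable {S}

/-! ### Exactness -/

section Exactness

variable {A B C : 𝒞} {x : A ⟶ B} {y : B ⟶ C}

theorem IsConflation.comp_eq_zero (h : S.IsConflation x y) : x ≫ y = 0 := by
  obtain ⟨δ, hδ⟩ := h
  obtain ⟨c, -, hc⟩ := S.et3 _ δ _ _ x y (S.realize_id_left A (isZero_zero 𝒞)) hδ (𝟙 A) x rfl
  rw [← hc, zero_comp]

theorem IsConflation.exists_desc (h : S.IsConflation x y) {T : 𝒞} (g : B ⟶ T) (hg : x ≫ g = 0) :
    ∃ c : C ⟶ T, y ≫ c = g := by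
  obtain ⟨δ, hδ⟩ := h
  obtain ⟨c, -, hc⟩ :=
    S.et3 δ _ x y _ _ hδ (S.realize_id_right T (isZero_zero 𝒞)) 0 g (by simp [hg])
  exact ⟨c, by simpa using hc⟩

theorem IsConflation.exists_lift (h : S.IsConflation x y) {T : 𝒞} (g : T ⟶ B) (hg : g ≫ y = 0) :
    ∃ a : T ⟶ A, a ≫ x = g := by
  obtain ⟨δ, hδ⟩ := h
  obtain ⟨a, -, ha⟩ :=
    S.et3_op _ δ _ _ x y (S.realize_id_left T (isZero_zero 𝒞)) hδ g 0 (by simp [hg])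
  exact ⟨a, by simpa using ha.symm⟩

theorem pull_proj_eq_zero {δ : Ext S.𝔼 C A} (h : S.𝔰 δ = SeqClass.mk x y) :
    pull S.𝔼 y δ = 0 := by
  obtain ⟨a, ha, -⟩ :=
    S.et3_op _ δ _ _ x y (S.realize_id_right B (isZero_zero 𝒞)) h (𝟙 B) y (by simp)
  rw [← ha, push_zero]

/-- Changing the middle term of a conflation along an isomorphism. -/
theorem IsConflation.mid_iso (h : S.IsConflation x y) {B' : 𝒞} (b : B ≅ B') :
    S.IsConflation (x ≫ b.hom) (b.inv ≫ y) := by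
  obtain ⟨δ, hδ⟩ := h
  exact ⟨δ, hδ.trans (SeqClass.mk_eq_iff.2 ⟨b, rfl, by simp⟩)⟩

theorem IsConflation.isIso_of_isZero_left (h : S.IsConflation x y) (hA : IsZero A) : IsIso y := by
  obtain ⟨δ, hδ⟩ := h
  rw [S.eq_zero_of_isZero_left hA δ, S.realize_id_right C hA, SeqClass.mk_eq_iff] at hδ
  obtain ⟨b, -, hb⟩ := hδ
  have : y = b.inv := by rw [← cancel_epi b.hom, hb, b.hom_inv_id]
  rw [this]
  infer_instance

theorem IsConflation.isIso_of_isZero_right (h : S.IsConflation x y) (hC : IsZero C) :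
    IsIso x := by
  obtain ⟨δ, hδ⟩ := h
  rw [S.eq_zero_of_isZero_right hC δ, S.realize_id_left A hC, SeqClass.mk_eq_iff] at hδ
  obtain ⟨b, hb, -⟩ := hδ
  rw [← hb, Category.id_comp]
  infer_instance

/-- A section `s` of the second morphism `y`, up to the isomorphism `s ≫ y`, is an inflation whose
cone is the first term. -/
theorem IsConflation.of_isIso_comp (h : S.IsConflation x y) {X : 𝒞} (s : X ⟶ B) [IsIso (s ≫ y)] :
    ∃ r : B ⟶ A, S.IsConflation s r := by
  have hxy := h.comp_eq_zero
  have hs : s ≫ y ≫ inv (s ≫ y) = 𝟙 X := by rw [← Category.assoc, IsIso.hom_inv_id]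
  obtain ⟨r, hr⟩ := h.exists_lift (𝟙 B - y ≫ inv (s ≫ y) ≫ s) (by simp)
  -- The extension vanishes because `y` has a section, hence `x` is a split monomorphism.
  have : Mono x := by
    obtain ⟨δ, hδ⟩ := h
    have h0 : δ = 0 := by
      have hsec : (inv (s ≫ y) ≫ s) ≫ y = 𝟙 C := by simp
      rw [← pull_id S.𝔼 δ, ← hsec, pull_comp, pull_proj_eq_zero hδ, pull_zero]
    rw [h0, S.realize_zero, SeqClass.mk_eq_iff] at hδ
    obtain ⟨b, hb, -⟩ := hδ
    rw [← hb]
    infer_instance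
  have hxr : x ≫ r = 𝟙 A := by
    rw [← cancel_mono x, Category.assoc, hr]
    simp [reassoc_of% hxy]
  have hsr : s ≫ r = 0 := by
    rw [← cancel_mono x, Category.assoc, hr]
    simp [reassoc_of% hs]
  let e : X ⊞ A ≅ B :=
    { hom := biprod.desc s x
      inv := biprod.lift (y ≫ inv (s ≫ y)) r
      hom_inv_id := by ext <;> simp [hs, hxr, hsr, reassoc_of% hxy]
      inv_hom_id := by simp [hr] }
  refine ⟨r, 0, ?_⟩
  rw [S.realize_zero_of_iso e]
  simp [e]

end Exactness

/-! ### Isomorphisms of the last term -/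

/-- An endomorphism of a conflation that is the identity on both ends is an isomorphism, as it
differs from the identity by a morphism of square zero. -/
theorem IsConflation.isIso_of_id_id {A B C : 𝒞} {x : A ⟶ B} {y : B ⟶ C}
    (h : S.IsConflation x y) (b : B ⟶ B) (h₁ : x ≫ b = x) (h₂ : b ≫ y = y) : IsIso b := by
  obtain ⟨u, hu⟩ := h.exists_desc (𝟙 B - b) (by simp [h₁])
  obtain ⟨t, ht⟩ := h.exists_lift (𝟙 B - b) (by simp [h₂])
  have hsq : (𝟙 B - b) ≫ (𝟙 B - b) = 0 := by
    nth_rw 1 [← ht]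
    rw [← hu, Category.assoc, reassoc_of% h.comp_eq_zero, zero_comp, comp_zero]
  have hsq' : b ≫ b = b + b - 𝟙 B := by
    simp only [Preadditive.sub_comp, Preadditive.comp_sub, Category.comp_id, Category.id_comp]
      at hsq
    rw [← sub_eq_zero, ← hsq]; abel
  refine ⟨𝟙 B + 𝟙 B - b, ?_, ?_⟩ <;>
    simp [Preadditive.comp_sub, Preadditive.sub_comp, hsq']

theorem realize_pull_of_iso {A B C C' : 𝒞} {x : A ⟶ B} {y : B ⟶ C} {δ : Ext S.𝔼 C A}
    (h : S.𝔰 δ = SeqClass.mk x y) (e : C ≅ C') :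
    S.𝔰 (pull S.𝔼 e.inv δ) = SeqClass.mk x (y ≫ e.hom) := by
  obtain ⟨B', x', y', h'⟩ := S.exists_realization (pull S.𝔼 e.inv δ)
  obtain ⟨b, hb₁, hb₂⟩ := S.realization _ _ _ _ _ _ h' h (𝟙 A) e.inv (push_id _ _)
  obtain ⟨b', hb₁', hb₂'⟩ := S.realization _ _ _ _ _ _ h h' (𝟙 A) e.hom
    (by rw [push_id, ← pull_comp, e.hom_inv_id, pull_id])
  rw [Category.id_comp] at hb₁ hb₁'
  have i₁ : IsIso (b ≫ b') := IsConflation.isIso_of_id_id ⟨_, h'⟩ _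
    (by rw [reassoc_of% hb₁, hb₁']) (by rw [Category.assoc, ← hb₂', ← reassoc_of% hb₂]; simp)
  have i₂ : IsIso (b' ≫ b) := IsConflation.isIso_of_id_id ⟨_, h⟩ _
    (by rw [reassoc_of% hb₁', hb₁]) (by rw [Category.assoc, ← hb₂, ← reassoc_of% hb₂']; simp)
  have : IsIso b := by
    have : IsSplitMono b := ⟨⟨⟨b' ≫ inv (b ≫ b'), by rw [← Category.assoc, IsIso.hom_inv_id]⟩⟩⟩
    have : Epi b := epi_of_epi b' b
    exact isIso_of_epi_of_isSplitMono b
  rw [h', SeqClass.mk_eq_iff]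
  exact ⟨asIso b, hb₁, by simp [← reassoc_of% hb₂]⟩

/-! ### Pullbacks of conflations -/

/-- A weak pullback `P` of two deflations `y₁`, `y₂` with the same target: the projections of `P`
are deflations with the same fibres. The object `P` is the middle term of the extension of `C` by
`A₁ ⊞ A₂` with components `δ₁` and `δ₂`, and (ET4) for the inclusions of `A₁` and `A₂` gives the two
projections. -/
theorem exists_pullback {A₁ A₂ B₁ B₂ C : 𝒞} {δ₁ : Ext S.𝔼 C A₁} {δ₂ : Ext S.𝔼 C A₂}
    {x₁ : A₁ ⟶ B₁} {y₁ : B₁ ⟶ C} {x₂ : A₂ ⟶ B₂} {y₂ : B₂ ⟶ C}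
    (h₁ : S.𝔰 δ₁ = SeqClass.mk x₁ y₁) (h₂ : S.𝔰 δ₂ = SeqClass.mk x₂ y₂) :
    ∃ (P : 𝒞) (u₁ : A₁ ⟶ P) (v₁ : P ⟶ B₂) (u₂ : A₂ ⟶ P) (v₂ : P ⟶ B₁),
      S.𝔰 (pull S.𝔼 y₂ δ₁) = SeqClass.mk u₁ v₁ ∧ S.IsConflation u₂ v₂ ∧
      v₁ ≫ y₂ = v₂ ≫ y₁ ∧ u₁ ≫ v₂ = x₁ := by
  let θ : Ext S.𝔼 C (A₁ ⊞ A₂) := push S.𝔼 biprod.inl δ₁ + push S.𝔼 biprod.inr δ₂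
  have hfst : push S.𝔼 biprod.fst θ = δ₁ := by
    simp only [θ, push_add, ← push_comp, biprod.inl_fst, biprod.inr_fst, push_id, push_zero_hom,
      add_zero]
  have hsnd : push S.𝔼 biprod.snd θ = δ₂ := by
    simp only [θ, push_add, ← push_comp, biprod.inl_snd, biprod.inr_snd, push_id, push_zero_hom,
      zero_add]
  obtain ⟨P, g, g', hθ⟩ := S.exists_realization θ
  obtain ⟨E₁, _, v₂, d₁, e₁, η₂, rfl, hd₁, he₁, hη₂, hde₁, -, -⟩ :=
    S.et4 0 θ _ _ g g' (S.realize_zero_swap A₁ A₂) hθ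
  obtain ⟨E₂, _, v₁, d₂, e₂, η₁, rfl, hd₂, he₂, hη₁, hde₂, -, hpush⟩ :=
    S.et4 0 θ _ _ g g' (S.realize_zero A₁ A₂) hθ
  rw [hfst, h₁, SeqClass.mk_eq_iff] at hde₁
  rw [hsnd, h₂, SeqClass.mk_eq_iff] at hde₂
  obtain ⟨b₁, hb₁, hb₁'⟩ := hde₁
  obtain ⟨b₂, hb₂, hb₂'⟩ := hde₂
  have hη : η₁ = pull S.𝔼 e₂ δ₁ := by
    have := congrArg (push S.𝔼 biprod.fst) hpush
    rwa [← push_comp, biprod.inl_fst, push_id, push_pull, hfst] at this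
  refine ⟨P, biprod.inl ≫ g, v₁ ≫ b₂.inv, biprod.inr ≫ g, v₂ ≫ b₁.inv, ?_, ?_, ?_, ?_⟩
  · rw [← hb₂', pull_comp, ← hη]
    exact realize_pull_of_iso hη₁ b₂.symm
  · exact ⟨_, realize_pull_of_iso hη₂ b₁.symm⟩
  · rw [← hb₂', ← hb₁']
    simp [he₁, he₂]
  · rw [Category.assoc, ← reassoc_of% hd₁, biprod.inl_fst_assoc, ← hb₁]
    simp

/-! ### The filtration subcategory -/

section Filt

variable {𝒳 : ObjectProperty 𝒞}

theorem HasFiltration.of_iso {n : ℕ} {M M' : 𝒞} (h : S.HasFiltration ⊤ 𝒳 n M) (e : M ≅ M') :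
    S.HasFiltration ⊤ 𝒳 n M' := by
  cases n with
  | zero => exact ⟨trivial, h.2.of_iso e.symm⟩
  | succ n =>
    obtain ⟨L, N, x, y, hL, hxy, hN⟩ := h
    exact ⟨L, N, _, _, hL, ⟨trivial, trivial, trivial, hxy.2.2.2.mid_iso e⟩, hN⟩

theorem filt_of_iso {M M' : 𝒞} (h : S.filt 𝒳 M) (e : M ≅ M') : S.filt 𝒳 M' :=
  h.imp fun _ hn => hn.of_iso e

theorem filt_of_isZero {Z : 𝒞} (hZ : IsZero Z) : S.filt 𝒳 Z :=
  ⟨0, trivial, hZ⟩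

theorem filt_of_mem {X : 𝒞} (hX : 𝒳 X) : S.filt 𝒳 X :=
  ⟨1, 0, X, 0, 𝟙 X, ⟨trivial, isZero_zero 𝒞⟩,
    ⟨trivial, trivial, trivial, _, S.realize_id_right X (isZero_zero 𝒞)⟩, hX⟩

theorem filt_of_conflation {A M B : 𝒞} {x : A ⟶ M} {y : M ⟶ B} (h : S.IsConflation x y)
    (hA : S.filt 𝒳 A) (hB : S.filt 𝒳 B) : S.filt 𝒳 M := by
  obtain ⟨n, hn⟩ := hB
  induction n generalizing M B with
  | zero =>
    have := h.isIso_of_isZero_right hn.2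
    exact filt_of_iso hA (asIso x)
  | succ n ih =>
    obtain ⟨L, N, i, p, hL, hip, hN⟩ := hn
    obtain ⟨δ, hδ⟩ := h
    obtain ⟨δ', hδ'⟩ := hip.2.2.2
    obtain ⟨E, h', k, d, e, δ'', -, -, -, hc, hde, -, -⟩ := S.et4_op δ δ' x y i p hδ hδ'
    obtain ⟨m, hm⟩ := ih ⟨_, hde⟩ hL
    exact ⟨m + 1, E, N, h', k, hm, ⟨trivial, trivial, trivial, _, hc⟩, hN⟩

/-- A filtration can also be peeled off from the bottom: its first nonzero step is a subobject
in `𝒳` whose cone has a shorter filtration. -/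
theorem HasFiltration.exists_bottom (h𝒳 : 𝒳.IsClosedUnderIsomorphisms) {n : ℕ} {M : 𝒞}
    (h : S.HasFiltration ⊤ 𝒳 (n + 1) M) :
    ∃ (X M' : 𝒞) (x : X ⟶ M) (y : M ⟶ M'), 𝒳 X ∧ S.IsConflation x y ∧
      S.HasFiltration ⊤ 𝒳 n M' := by
  induction n generalizing M with
  | zero =>
    obtain ⟨L, N, x, y, hL, hxy, hN⟩ := h
    have := hxy.2.2.2.isIso_of_isZero_left hL.2
    exact ⟨M, L, 𝟙 M, 0, 𝒳.prop_of_iso (asIso y).symm hN, ⟨_, S.realize_id_left M hL.2⟩, hL⟩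
  | succ n ih =>
    obtain ⟨L, N, i, p, hL, hip, hN⟩ := h
    obtain ⟨X, L', x, y, hX, ⟨δ, hδ⟩, hL'⟩ := ih hL
    obtain ⟨δ', hδ'⟩ := hip.2.2.2
    obtain ⟨E, k, h', d, e, δ'', -, -, -, hc, hde, -, -⟩ := S.et4 δ δ' x y i p hδ hδ'
    exact ⟨X, E, k, h', hX, ⟨_, hc⟩, L', N, d, e, hL', ⟨trivial, trivial, trivial, _, hde⟩, hN⟩

/-- Every nonzero morphism from a member of the semibrick to a filtered object is an inflation
whose cone is filtered: composed with the top quotient of the filtration it is zero, and then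
factors through a shorter filtration, or an isomorphism, and then splits off. -/
theorem exists_conflation_of_ne_zero (h𝒳 : IsSemibrick 𝒳) {X M : 𝒞} (hX : 𝒳 X)
    (hM : S.filt 𝒳 M) (f : X ⟶ M) (hf : f ≠ 0) :
    ∃ (N : 𝒞) (y : M ⟶ N), S.IsConflation f y ∧ S.filt 𝒳 N := by
  obtain ⟨n, hn⟩ := hM
  induction n generalizing M with
  | zero => exact absurd (hn.2.eq_of_tgt _ _) hf
  | succ n ih =>
    obtain ⟨L, N, i, p, hL, hip, hN⟩ := hn
    by_cases h0 : f ≫ p = 0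
    · obtain ⟨k, rfl⟩ := hip.2.2.2.exists_lift f h0
      obtain ⟨L', y, ⟨δ, hδ⟩, m, hm⟩ := ih k (by rintro rfl; simp at hf) hL
      obtain ⟨δ', hδ'⟩ := hip.2.2.2
      obtain ⟨E, _, h', d, e, δ'', rfl, -, -, hc, hde, -, -⟩ := S.et4 δ δ' k y i p hδ hδ'
      exact ⟨E, h', ⟨_, hc⟩, m + 1, L', N, d, e, hm, ⟨trivial, trivial, trivial, _, hde⟩, hN⟩
    · have := h𝒳.isIso_of_ne_zero hX hN _ h0
      obtain ⟨r, hr⟩ := hip.2.2.2.of_isIso_comp f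
      exact ⟨L, r, hr, n, hL⟩

/-! ### Admissibility -/

/-- Admissibility lifts along morphisms of conflations: if both `X ⟶ M` and `X ⟶ M ⟶ N` are
inflations, and the morphism `f' : M' ⟶ N'` which `f` induces on their cones is admissible, then so
is `f`. -/
theorem isAdmissibleIn_of_isAdmissibleIn_cone (h𝒳 : IsSemibrick 𝒳) {X M M' N N' : 𝒞}
    (hX : 𝒳 X) (hM : S.filt 𝒳 M) (hN : S.filt 𝒳 N) {x : X ⟶ M} {y : M ⟶ M'} {z : N ⟶ N'}
    {f : M ⟶ N} {f' : M' ⟶ N'} {δ : Ext S.𝔼 M' X} {δ' : Ext S.𝔼 N' X}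
    (hδ : S.𝔰 δ = SeqClass.mk x y) (hδ' : S.𝔰 δ' = SeqClass.mk (x ≫ f) z) (hf' : y ≫ f' = f ≫ z)
    (hpull : δ = pull S.𝔼 f' δ')
    (hxf : x ≫ f ≠ 0) (h : S.IsAdmissibleIn (S.filt 𝒳) f') :
    S.IsAdmissibleIn (S.filt 𝒳) f := by
  obtain ⟨W', p, i, ⟨K, k, hK, -, hW', κ, hκ⟩, ⟨Q, q, -, -, hQ, ε, hε⟩, rfl⟩ := h
  -- The preimage `E` of `W'` in `N`.
  obtain ⟨E, j, r, d, e, η, -, hd, hje, hη, hde, -, -⟩ := S.et4_op δ' ε (x ≫ f) z i q hδ' hε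
  -- `M` is the pullback of `E` and `M'` over `W'`.
  obtain ⟨P, u₁, v₁, u₂, v₂, h₁, h₂, hsq, hu⟩ := exists_pullback hde hκ
  rw [← pull_comp, ← hpull, hδ, SeqClass.mk_eq_iff] at h₁
  obtain ⟨b, hb, hb'⟩ := h₁
  obtain ⟨g, hg⟩ : ∃ g, g = b.hom ≫ v₂ := ⟨_, rfl⟩
  have hxg : x ≫ g = d := by rw [hg, reassoc_of% hb, hu]
  have hge : g ≫ e = y ≫ p := by rw [hg, Category.assoc, ← hsq, reassoc_of% hb']
  have hyz := IsConflation.comp_eq_zero ⟨_, hδ⟩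
  -- `f` and `g ≫ j` induce the same morphisms on `X` and on `M'`, so they differ by a morphism
  -- `t ≫ x ≫ f` with `t : M ⟶ X`.
  obtain ⟨t, ht⟩ := IsConflation.exists_lift ⟨_, hδ'⟩ (f - g ≫ j) <| by
    rw [Preadditive.sub_comp, ← hf', Category.assoc, hje, reassoc_of% hge, sub_self]
  -- `x ≫ t` is an endomorphism of a brick and not an isomorphism.
  have hxt : x ≫ t = 0 := by
    by_contra h0
    have := h𝒳.isIso_of_ne_zero hX hX _ h0
    apply hxf
    rw [← cancel_epi (x ≫ t), Category.assoc, ht, Preadditive.comp_sub, reassoc_of% hxg, hd,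
      sub_self, comp_zero]
  obtain ⟨s, rfl⟩ := IsConflation.exists_desc ⟨_, hδ⟩ t hxt
  -- The difference is absorbed by the unipotent automorphism `𝟙 M + y ≫ s ≫ x` of `M`.
  let a : M ≅ M :=
    { hom := 𝟙 M - y ≫ s ≫ x
      inv := 𝟙 M + y ≫ s ≫ x
      hom_inv_id := by simp [reassoc_of% hyz]
      inv_hom_id := by simp [reassoc_of% hyz] }
  have hf : f = (a.inv ≫ g) ≫ j := by
    have : f = g ≫ j + (y ≫ s) ≫ x ≫ f := by rw [ht]; abel
    rw [this]
    simp [a, reassoc_of% hxg, hd]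
  have hE : S.filt 𝒳 E := filt_of_conflation ⟨_, hde⟩ (filt_of_mem hX) hW'
  refine ⟨E, a.inv ≫ g, j, ⟨K, (u₂ ≫ b.inv) ≫ a.hom, hK, hM, hE, ?_⟩,
    ⟨Q, r, hE, hN, hQ, η, hη⟩, hf⟩
  have := (h₂.mid_iso b.symm).mid_iso a
  simpa [hg] using this

theorem isAdmissibleIn_filt_zero {M N : 𝒞} (hM : S.filt 𝒳 M) (hN : S.filt 𝒳 N) :
    S.IsAdmissibleIn (S.filt 𝒳) (0 : M ⟶ N) :=
  have h0 := isZero_zero 𝒞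
  ⟨0, 0, 0, ⟨M, 𝟙 M, hM, hM, filt_of_isZero h0, _, S.realize_id_left M h0⟩,
    ⟨N, 𝟙 N, filt_of_isZero h0, hN, hN, _, S.realize_id_right N h0⟩, by simp⟩

theorem isAdmissibleIn_filt (h𝒳 : IsSemibrick 𝒳) {M N : 𝒞} (f : M ⟶ N) (hM : S.filt 𝒳 M)
    (hN : S.filt 𝒳 N) : S.IsAdmissibleIn (S.filt 𝒳) f := by
  obtain ⟨n, hn⟩ := hM
  induction n generalizing M N with
  | zero =>
    rw [hn.2.eq_of_src f 0]
    exact isAdmissibleIn_filt_zero ⟨0, hn⟩ hN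
  | succ n ih =>
    obtain ⟨X, M', x, y, hX, hxy, hM'⟩ := hn.exists_bottom h𝒳.closedUnderIso
    by_cases h0 : x ≫ f = 0
    · obtain ⟨f', rfl⟩ := hxy.exists_desc f h0
      obtain ⟨W, p, i, ⟨K, k, hK, -, hW, κ, hκ⟩, hi, rfl⟩ := ih f' hN hM'
      obtain ⟨δ, hδ⟩ := hxy
      obtain ⟨E, h', _, d, e, η, rfl, -, -, hη, hde, -, -⟩ := S.et4_op δ κ x y k p hδ hκ
      have hE : S.filt 𝒳 E := filt_of_conflation ⟨_, hde⟩ (filt_of_mem hX) hK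
      exact ⟨W, y ≫ p, i, ⟨E, h', hE, ⟨_, hn⟩, hW, η, hη⟩, hi, by simp⟩
    · obtain ⟨N', z, ⟨δ', hδ'⟩, hN'⟩ := exists_conflation_of_ne_zero h𝒳 hX hN _ h0
      obtain ⟨δ, hδ⟩ := hxy
      obtain ⟨f', hpull, hf'⟩ := S.et3 δ δ' _ _ _ _ hδ hδ' (𝟙 X) f (by simp)
      rw [push_id] at hpull
      exact isAdmissibleIn_of_isAdmissibleIn_cone h𝒳 hX ⟨_, hn⟩ hN hδ hδ' hf' hpull h0
        (ih f' hN' hM')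

/-! ### Wideness and simple objects -/

theorem isWide_filt (h𝒳 : IsSemibrick 𝒳) : S.IsWide (S.filt 𝒳) where
  closedUnderIso := ⟨fun e h => filt_of_iso h e⟩
  containsZero _ := filt_of_isZero
  extensionClosed := by
    ext M
    refine ⟨fun ⟨A, B, x, y, hA, hB, h⟩ => filt_of_conflation h hA hB, fun h => ?_⟩
    exact ⟨M, 0, 𝟙 M, 0, h, filt_of_isZero (isZero_zero 𝒞), _,
      S.realize_id_left M (isZero_zero 𝒞)⟩
  admissible := isAdmissibleIn_filt h𝒳

theorem sim_filt_le (h𝒳 : IsSemibrick 𝒳) : S.sim (S.filt 𝒳) ≤ 𝒳 := by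
  rintro M ⟨⟨n, hn⟩, hM0, hM⟩
  cases n with
  | zero => exact absurd hn.2 hM0
  | succ n =>
    obtain ⟨L, N, x, y, hL, hxy, hN⟩ := id hn
    have hL0 : IsZero L := by
      by_contra h
      exact hM ⟨L, N, x, y, ⟨⟨n, hL⟩, ⟨_, hn⟩, filt_of_mem hN, hxy.2.2.2⟩, h,
        h𝒳.not_isZero_of_mem hN⟩
    have := hxy.2.2.2.isIso_of_isZero_left hL0
    have := h𝒳.closedUnderIso
    exact 𝒳.prop_of_iso (asIso y).symm hN

theorem hasFiltration_filt_iff (n : ℕ) (M : 𝒞) :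
    S.HasFiltration (S.filt 𝒳) 𝒳 n M ↔ S.HasFiltration ⊤ 𝒳 n M := by
  induction n generalizing M with
  | zero => exact ⟨fun h => ⟨trivial, h.2⟩, fun h => ⟨filt_of_isZero h.2, h.2⟩⟩
  | succ n ih =>
    constructor
    · rintro ⟨L, N, x, y, hL, hxy, hN⟩
      exact ⟨L, N, x, y, (ih L).1 hL, ⟨trivial, trivial, trivial, hxy.2.2.2⟩, hN⟩
    · rintro h
      obtain ⟨L, N, x, y, hL, hxy, hN⟩ := id h
      exact ⟨L, N, x, y, (ih L).2 hL, ⟨⟨n, hL⟩, ⟨_, h⟩, filt_of_mem hN, hxy.2.2.2⟩, hN⟩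

theorem filtIn_filt_eq : S.filtIn (S.filt 𝒳) 𝒳 = S.filt 𝒳 := by
  ext M
  exact exists_congr fun n => hasFiltration_filt_iff n M

end Filt

end ExtriangulatedStructure

end Extriangulated

theorem mainTheorem3 {𝒞 : Type u} [Category.{v} 𝒞] [Preadditive 𝒞] [HasZeroObject 𝒞]
    [HasBinaryBiproducts 𝒞] (S : Extriangulated.ExtriangulatedStructure.{w} 𝒞)
    (𝒳 : ObjectProperty 𝒞) (h𝒳 : Extriangulated.IsSemibrick 𝒳) :
    S.IsWide (S.filt 𝒳) ∧
      (S.IsSimpleSet 𝒳 →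
        (S.IsWide (S.filt 𝒳) ∧ S.IsLength (S.filt 𝒳)) ∧ S.sim (S.filt 𝒳) = 𝒳) := by
  have hwide := Extriangulated.ExtriangulatedStructure.isWide_filt (S := S) h𝒳
  refine ⟨hwide, fun hs => ?_⟩
  have hsim : S.sim (S.filt 𝒳) = 𝒳 :=
    le_antisymm (Extriangulated.ExtriangulatedStructure.sim_filt_le h𝒳) hs
  refine ⟨⟨hwide, ?_⟩, hsim⟩
  rw [Extriangulated.ExtriangulatedStructure.IsLength, hsim,
    Extriangulated.ExtriangulatedStructure.filtIn_filt_eq]
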